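/- A weighted graph $(V,c)$ is a nonempty, at most countable set $V$ with a symmetric weight function $c:V\times V\to[0,\infty)$ satisfying $c(x,x)=0$; vertices $x,y$ are adjacent if $c(x,y)>0$, and $c_x:=\sum_{y\in V}c(x,y)\in[0,\infty]$. If $(V,c)$ is finite and connected, its effective resistance is $R(x,y):=\phi^{xy}(x)$, where $\phi=\phi^{xy}$ is the unique solution of $\phi(z)-\sum_{w}\frac{c(z,w)}{c_z}\phi(w)=\frac1{c_x}\mathbf 1_x(z)-\frac1{c_y}\mathbf 1_y(z)$ for all $z\in V$, with $\phi(y)=0$. A Dirichlet form on a finite set $W$ is a quadratic form $\mathcal F$ on $\mathbb R^W$ with $\mathcal F\ge 0$, $\mathcal F(u)=0$ if and only if $u$ is constant, and $\mathcal F(\min\{1,\max\{u,0\}\})\le\mathcal F(u)$ for all $u$. Put $R_{\mathcal F}(x,y)=\big(\min\{\mathcal F(u):u(x)=1,\ u(y)=0\}\big)^{-1}$ for $x\ne y$ and $R_{\mathcal F}(x,x)=0$. A function $R:V\times V\to[0,\infty)$ is a resistance metric on $V$ if for every finite $W\subseteq V$ there is a Dirichlet form $\mathcal F$ on $W$ with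 $R|_{W\times W}=R_{\mathcal F}$. Let $R$ be a resistance metric on a countably infinite set $V$ and let $V_1\subseteq V_2\subseteq\cdots$ be finite sets with $\bigcup_n V_n=V$. For each $n$ with $V_n\neq\emptyset$ let $G_n=(V_n,c_n)$ be the unique connected graph on $V_n$ with effective resistance $R|_{V_n\times V_n}$, and let $G_R=(V,c)$ with $c(x,y)=\lim_{n\to\infty}c_n(x,y)$ be the limit graph of $R$. For $x\in V_n$ let $\mathbb P^n_x$ be the law of the random walk on $G_n$ started in $x$ (jumping from $y$ to $z$ with probability $c_n(y,z)/(c_n)_y$), regarded as a Borel probability measure on $\Omega=V^{\mathbb N_0}$ with the product of the discrete topologies. (For a fixed $x$ it is defined for all sufficiently large $n$.) **Theorem.** Suppose that $$c_x=\sum_{y\in V}c(x,y)=\lim_{n\to\infty}(c_n)_x<\infty\qquad\text{for all }x\in V.$$ Then for every $x\in V$ the whole sequence $(\mathbb P^n_x)_n$ converges weakly to $\mathbb P_x$, the law on $\Omega$ of the random walk on $G_R$ started in $x$ (jumping from $y$ to $z$ with probability $c(y,z)/c_y$). -/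

import Mathlib

open Filter Topology MeasureTheory ProbabilityTheory
open scoped NNReal ENNReal

noncomputable section

/-- A weighted graph on the vertex set `V`: a symmetric weight function with values in `[0, ∞)`
that vanishes on the diagonal. Two vertices are adjacent iff their weight is positive. -/
structure WeightedGraph (V : Type*) where
  weight : V → V → ℝ≥0
  weight_self : ∀ x, weight x x = 0
  weight_symm : ∀ x y, weight x y = weight y x

namespace WeightedGraph

variable {V : Type*}

/-- The graph without edges. -/
def edgeless (V : Type*) : WeightedGraph V where
  weight _ _ := 0
  weight_self _ := rfl
  weight_symm _ _ := rfl

/-- The vertex weight `c_x = ∑_y c(x,y)`, with values in `[0, ∞]`. -/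
def vertexWeight (G : WeightedGraph V) (x : V) : ℝ≥0∞ := ∑' y, (G.weight x y : ℝ≥0∞)

/-- The underlying simple graph: `x` and `y` are adjacent iff `c(x,y) > 0`. -/
def toSimpleGraph (G : WeightedGraph V) : SimpleGraph V where
  Adj x y := 0 < G.weight x y
  symm := ⟨fun x y h => by rw [G.weight_symm y x]; exact h⟩
  loopless := ⟨fun x h => by rw [G.weight_self x] at h; exact lt_irrefl _ h⟩

def Connected (G : WeightedGraph V) : Prop := G.toSimpleGraph.Connected

/-! ### Effective resistance of finite graphs -/

/-- The normalized Laplacian `(Δ f)(x) = f(x) - ∑_y c(x,y)/c_x f(y)` of a finite graph. -/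
def laplacian [Fintype V] (G : WeightedGraph V) (f : V → ℝ) (x : V) : ℝ :=
  f x - ∑ y, (G.weight x y : ℝ) / (G.vertexWeight x).toReal * f y

open Classical in
/-- `φ` solves the Dirichlet problem `Δ φ = (1/c_x) 1_x - (1/c_y) 1_y`, `φ(y) = 0`. -/
def IsDirichletSolution [Fintype V] (G : WeightedGraph V) (x y : V) (φ : V → ℝ) : Prop :=
  (∀ z, G.laplacian φ z = (1 / (G.vertexWeight x).toReal) * (if z = x then 1 else 0)
      - (1 / (G.vertexWeight y).toReal) * (if z = y then 1 else 0)) ∧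
  φ y = 0

/-- `R` is the effective resistance of the finite graph `G`: `R(x,y) = φ^{xy}(x)`, where `φ^{xy}`
is the solution of the Dirichlet problem (which is unique when `G` is connected). -/
def IsEffectiveResistance [Fintype V] (G : WeightedGraph V) (R : V → V → ℝ) : Prop :=
  ∀ x y, ∃ φ : V → ℝ, G.IsDirichletSolution x y φ ∧ R x y = φ x

open Classical in
/-- A graph on a finite set `W` of vertices, regarded as a graph on all of `V` in which the
vertices outside `W` are isolated. -/
def extend {W : Finset V} (G : WeightedGraph W) : WeightedGraph V where
  weight x y := if h : x ∈ W ∧ y ∈ W then G.weight ⟨x, h.1⟩ ⟨y, h.2⟩ else 0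
  weight_self x := by
    split_ifs
    · exact G.weight_self _
    · rfl
  weight_symm x y := by
    by_cases h : x ∈ W ∧ y ∈ W
    · rw [dif_pos h, dif_pos h.symm]; exact G.weight_symm _ _
    · rw [dif_neg h, dif_neg fun h' => h h'.symm]

/-! ### The random walk -/

open Classical in
/-- The law of one step of the random walk from `y`: jump to `z` with probability `c(y,z)/c_y`.
When `c_y` is `0` or `∞` these probabilities make no sense, and the walk is made to stay
at `y`. -/
def stepPMF (G : WeightedGraph V) (y : V) : PMF V :=
  if h : G.vertexWeight y ≠ 0 ∧ G.vertexWeight y ≠ ∞ then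
    PMF.normalize (fun z => (G.weight y z : ℝ≥0∞)) h.1 h.2
  else PMF.pure y

variable [Countable V] [MeasurableSpace V] [DiscreteMeasurableSpace V]

/-- The transition kernel of the random walk. -/
def stepKernel (G : WeightedGraph V) : Kernel V V where
  toFun y := (G.stepPMF y).toMeasure
  measurable' := Measurable.of_discrete

instance (G : WeightedGraph V) : IsMarkovKernel G.stepKernel :=
  ⟨fun y => PMF.toMeasure.isProbabilityMeasure (G.stepPMF y)⟩

/-- The transition kernel as a function of the path up to time `n`: only the position at
time `n` matters. -/
def pathKernel (G : WeightedGraph V) (n : ℕ) : Kernel ((i : Finset.Iic n) → V) V :=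
  G.stepKernel.comap (fun ω => ω ⟨n, Finset.mem_Iic.2 le_rfl⟩) (measurable_pi_apply _)

instance (G : WeightedGraph V) (n : ℕ) : IsMarkovKernel (G.pathKernel n) :=
  inferInstanceAs (IsMarkovKernel (G.stepKernel.comap _ _))

/-- The random walk on `G` started in `x`: the law on the space of trajectories `ℕ → V` of the
Markov chain with initial position `x` and transition probabilities `c(y,z)/c_y`. -/
def randomWalk (G : WeightedGraph V) (x : V) : ProbabilityMeasure (ℕ → V) :=
  ⟨Kernel.traj (X := fun _ => V) G.pathKernel 0 (fun _ => x), inferInstance⟩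

end WeightedGraph

/-! ### Resistance metrics -/

/-- Dirichlet forms on a finite set `X`: symmetric quadratic forms on the functions `X → ℝ`. -/
structure IsDirichletForm {X : Type*} (F : QuadraticForm ℝ (X → ℝ)) : Prop where
  nonneg : ∀ u, 0 ≤ F u
  eq_zero_iff : ∀ u, F u = 0 ↔ ∃ k : ℝ, ∀ x, u x = k
  markov : ∀ u : X → ℝ, F (fun x => min 1 (max (u x) 0)) ≤ F u

/-- `R_F(x,y) = (min {F(u) : u(x) = 1, u(y) = 0})⁻¹`. For `x = y` the set is empty, and
`sInf ∅ = 0`, `0⁻¹ = 0` give the usual convention `R_F(x,x) = 0`. -/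
def dirichletResistance {X : Type*} (F : QuadraticForm ℝ (X → ℝ)) (x y : X) : ℝ :=
  (sInf {r : ℝ | ∃ u : X → ℝ, u x = 1 ∧ u y = 0 ∧ F u = r})⁻¹

/-- `R` is a resistance metric on `V`: on every finite subset it is the resistance of some
Dirichlet form. -/
def IsResistanceMetric {V : Type*} (R : V → V → ℝ) : Prop :=
  (∀ x y, 0 ≤ R x y) ∧
  ∀ W : Finset V, ∃ F : QuadraticForm ℝ (W → ℝ), IsDirichletForm F ∧
    ∀ x y : W, R x y = dirichletResistance F x y

/-- A finite exhaustion of `V`: an increasing sequence of finite subsets with union `V`. -/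
def IsFiniteExhaustion {V : Type*} (Vn : ℕ → Finset V) : Prop :=
  (∀ n, Vn n ⊆ Vn (n + 1)) ∧ ∀ x, ∃ n, x ∈ Vn n

open Classical in
/-- The (unique) connected graph on the finite set `W` with effective resistance `R` restricted
to `W`; the edgeless graph if there is none. -/
def resistanceGraph {V : Type*} (R : V → V → ℝ) (W : Finset V) : WeightedGraph W :=
  if h : ∃ G : WeightedGraph W, G.Connected ∧ G.IsEffectiveResistance (fun x y => R x y) then
    h.choose
  else WeightedGraph.edgeless W

/-- The graph `G_n` with effective resistance `R` on `V_n`, regarded as a graph on `V` in which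
the vertices outside `V_n` are isolated. -/
def approxGraph {V : Type*} (R : V → V → ℝ) (Vn : ℕ → Finset V) (n : ℕ) : WeightedGraph V :=
  (resistanceGraph R (Vn n)).extend

/-- The limit graph of `R`: `c(x,y) = lim_n c_n(x,y)`. -/
def limitGraph {V : Type*} (R : V → V → ℝ) (Vn : ℕ → Finset V) : WeightedGraph V where
  weight x y := limUnder atTop fun n => (approxGraph R Vn n).weight x y
  weight_self x := by
    simp only [WeightedGraph.weight_self]
    exact tendsto_const_nhds.limUnder_eq
  weight_symm x y := by
    simp only [WeightedGraph.weight_symm _ x y]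

end

noncomputable section

namespace WeightedGraph

section Laplacian

variable {V : Type*} [Fintype V]

/-- The unnormalized Laplacian `(L f)(x) = ∑_y c(x,y) (f(x) - f(y))` of a finite graph. -/
def weightedLaplacian (G : WeightedGraph V) : (V → ℝ) →ₗ[ℝ] (V → ℝ) where
  toFun f x := ∑ y, (G.weight x y : ℝ) * (f x - f y)
  map_add' f g := by
    ext x
    simp only [Pi.add_apply, ← Finset.sum_add_distrib]
    exact Finset.sum_congr rfl fun y _ => by ring
  map_smul' r f := by
    ext x
    simp only [Pi.smul_apply, smul_eq_mul, RingHom.id_apply, Finset.mul_sum]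
    exact Finset.sum_congr rfl fun y _ => by ring

lemma weightedLaplacian_apply (G : WeightedGraph V) (f : V → ℝ) (x : V) :
    G.weightedLaplacian f x = ∑ y, (G.weight x y : ℝ) * (f x - f y) := rfl

lemma weightedLaplacian_const (G : WeightedGraph V) (k : ℝ) :
    G.weightedLaplacian (fun _ => k) = 0 := by
  ext x
  simp [weightedLaplacian_apply]

lemma sum_mul_weightedLaplacian_comm (G : WeightedGraph V) (f g : V → ℝ) :
    ∑ x, g x * G.weightedLaplacian f x = ∑ x, f x * G.weightedLaplacian g x := by
  have key : ∀ u v : V → ℝ, ∑ x, u x * G.weightedLaplacian v x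
      = ∑ x, ∑ y, (G.weight x y : ℝ) * (u x * v x) - ∑ x, ∑ y, (G.weight x y : ℝ) * (u x * v y) := by
    intro u v
    simp only [weightedLaplacian_apply, Finset.mul_sum, ← Finset.sum_sub_distrib]
    exact Finset.sum_congr rfl fun x _ => Finset.sum_congr rfl fun y _ => by ring
  rw [key, key]
  congr 1
  · exact Finset.sum_congr rfl fun x _ => Finset.sum_congr rfl fun y _ => by ring
  · rw [Finset.sum_comm]
    exact Finset.sum_congr rfl fun x _ => Finset.sum_congr rfl fun y _ => by
      rw [G.weight_symm]; ring

lemma sum_weightedLaplacian (G : WeightedGraph V) (f : V → ℝ) :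
    ∑ x, G.weightedLaplacian f x = 0 := by
  simpa [weightedLaplacian_const] using G.sum_mul_weightedLaplacian_comm f (fun _ => 1)

lemma vertexWeight_eq_coe_sum (G : WeightedGraph V) (x : V) :
    G.vertexWeight x = ((∑ y, G.weight x y : ℝ≥0) : ℝ≥0∞) := by
  rw [vertexWeight, tsum_fintype, ENNReal.ofNNReal_finsetSum]

lemma toReal_vertexWeight (G : WeightedGraph V) (x : V) :
    (G.vertexWeight x).toReal = ∑ y, (G.weight x y : ℝ) := by
  rw [vertexWeight_eq_coe_sum, ENNReal.coe_toReal, NNReal.coe_sum]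

lemma toReal_vertexWeight_mul_laplacian (G : WeightedGraph V) (f : V → ℝ) (x : V) :
    (G.vertexWeight x).toReal * G.laplacian f x = G.weightedLaplacian f x := by
  simp only [laplacian, weightedLaplacian_apply, mul_sub, Finset.mul_sum, Finset.sum_sub_distrib,
    ← Finset.sum_mul, ← toReal_vertexWeight]
  congr 1
  refine Finset.sum_congr rfl fun y _ => ?_
  by_cases h : (G.vertexWeight x).toReal = 0
  · have : (G.weight x y : ℝ) = 0 := by
      rw [toReal_vertexWeight, Finset.sum_eq_zero_iff_of_nonneg fun _ _ => NNReal.coe_nonneg _] at h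
      exact h y (Finset.mem_univ y)
    simp [this]
  · field_simp

lemma Connected.toReal_vertexWeight_pos {G : WeightedGraph V} (hG : G.Connected) {x y : V}
    (hxy : x ≠ y) : 0 < (G.vertexWeight x).toReal := by
  have : Nontrivial V := ⟨x, y, hxy⟩
  obtain ⟨z, hz⟩ := hG.preconnected.exists_adj_of_nontrivial x
  rw [toReal_vertexWeight]
  exact Finset.sum_pos' (fun _ _ => NNReal.coe_nonneg _) ⟨z, Finset.mem_univ z, hz⟩

/-- Minimum principle. -/
lemma Connected.nonneg_of_weightedLaplacian {G : WeightedGraph V} (hG : G.Connected) {f : V → ℝ}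
    (hf : ∀ z, f z < 0 → 0 ≤ G.weightedLaplacian f z) {y : V} (hy : 0 ≤ f y) (x : V) :
    0 ≤ f x := by
  have : Nonempty V := ⟨x⟩
  obtain ⟨m, hm⟩ := Finite.exists_min f
  by_contra! hx
  have hneg : f m < 0 := (hm x).trans_lt hx
  have step : ∀ z w, G.toSimpleGraph.Adj z w → f z = f m → f w = f m := by
    intro z w hzw hz
    have h0 := hf z (hz ▸ hneg)
    rw [weightedLaplacian_apply] at h0
    have hle : ∀ v ∈ Finset.univ, (G.weight z v : ℝ) * (f z - f v) ≤ 0 := fun v _ =>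
      mul_nonpos_of_nonneg_of_nonpos (NNReal.coe_nonneg _) (by rw [hz]; linarith [hm v])
    have := (Finset.sum_eq_zero_iff_of_nonpos hle).1 (le_antisymm (Finset.sum_nonpos hle) h0) w
      (Finset.mem_univ w)
    have hpos : (0 : ℝ) < G.weight z w := hzw
    rcases mul_eq_zero.1 this with h | h
    · exact absurd h hpos.ne'
    · linarith
  have walk : ∀ {z w} (_ : G.toSimpleGraph.Walk z w), f z = f m → f w = f m := by
    intro z w p
    induction p with
    | nil => exact id
    | cons h _ ih => exact fun hz => ih (step _ _ h hz)
  obtain ⟨p⟩ := hG.preconnected m y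
  linarith [walk p rfl]

lemma Connected.eq_of_weightedLaplacian_eq_zero {G : WeightedGraph V} (hG : G.Connected)
    {f : V → ℝ} (hf : G.weightedLaplacian f = 0) (x y : V) : f x = f y := by
  have key : ∀ g : V → ℝ, G.weightedLaplacian g = 0 → ∀ x y, g x ≤ g y := by
    intro g hg x y
    have h0 : G.weightedLaplacian (g - fun _ => g x) = 0 := by
      rw [map_sub, hg, weightedLaplacian_const, sub_zero]
    have := hG.nonneg_of_weightedLaplacian (f := g - fun _ => g x) (fun z _ => by simp [h0])
      (y := x) (by simp) y
    simpa using this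
  exact le_antisymm (key f hf x y) (key f hf y x)

open Classical in
lemma Connected.isDirichletSolution_iff {G : WeightedGraph V} (hG : G.Connected) {x y : V}
    {f : V → ℝ} : G.IsDirichletSolution x y f ↔
      (∀ z, G.weightedLaplacian f z = (if z = x then 1 else 0) - (if z = y then 1 else 0)) ∧
      f y = 0 := by
  refine and_congr_left fun hfy => forall_congr' fun z => ?_
  rcases eq_or_ne x y with rfl | hxy
  · rw [sub_self, sub_self, ← toReal_vertexWeight_mul_laplacian, mul_eq_zero]
    refine ⟨Or.inr, fun h => h.elim (fun h => ?_) id⟩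
    have hzx : z = x := by
      by_contra hn
      exact (hG.toReal_vertexWeight_pos hn).ne' h
    simp only [laplacian, h, div_zero, zero_mul, Finset.sum_const_zero, sub_zero]
    rw [hzx, hfy]
  · have hx := hG.toReal_vertexWeight_pos hxy
    have hy := hG.toReal_vertexWeight_pos hxy.symm
    have hz : 0 < (G.vertexWeight z).toReal := by
      rcases eq_or_ne z x with rfl | h
      · exact hx
      · exact hG.toReal_vertexWeight_pos h
    rw [← toReal_vertexWeight_mul_laplacian, ← mul_right_inj' hz.ne']
    suffices h : (G.vertexWeight z).toReal * (1 / (G.vertexWeight x).toReal * (if z = x then 1 else 0)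
        - 1 / (G.vertexWeight y).toReal * (if z = y then 1 else 0))
        = (if z = x then 1 else 0) - (if z = y then 1 else 0) by rw [h]
    rw [mul_sub]
    congr 1
    · split_ifs with h
      · subst h; field_simp
      · simp
    · split_ifs with h
      · subst h; field_simp
      · simp

open Classical in
/-- The solution of the Dirichlet problem in terms of the effective resistance. -/
lemma Connected.isDirichletSolution_eq {G : WeightedGraph V} (hG : G.Connected)
    {R : V → V → ℝ} (hR : G.IsEffectiveResistance R) {x y : V} {f : V → ℝ}
    (hf : G.IsDirichletSolution x y f) (z : V) : R x z = R x y + R z y - 2 * f z := by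
  have unique : ∀ {a b : V} {u v : V → ℝ}, G.IsDirichletSolution a b u →
      G.IsDirichletSolution a b v → ∀ w, u w = v w := by
    intro a b u v hu hv w
    rw [hG.isDirichletSolution_iff] at hu hv
    have h0 : G.weightedLaplacian (u - v) = 0 := by
      ext t; rw [map_sub, Pi.sub_apply, hu.1, hv.1, sub_self]; rfl
    have := hG.eq_of_weightedLaplacian_eq_zero h0 w b
    simp only [Pi.sub_apply, hu.2, hv.2] at this
    linarith
  obtain ⟨p, hp, hpx⟩ := hR x y
  obtain ⟨g, hg, hgz⟩ := hR z y
  obtain ⟨q, hq, hqx⟩ := hR x z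
  rw [hpx, hgz, hqx, unique hp hf]
  rw [hG.isDirichletSolution_iff] at hf hg hq
  have hsymm : f z = g x := by
    have := G.sum_mul_weightedLaplacian_comm f g
    simp only [hf.1, hg.1, mul_sub, Finset.sum_sub_distrib, mul_ite, mul_one, mul_zero,
      Finset.sum_ite_eq', Finset.mem_univ, if_true, hf.2, hg.2, sub_zero] at this
    exact this.symm
  have h0 : G.weightedLaplacian (q - (f - g)) = 0 := by
    ext t
    simp only [map_sub, Pi.sub_apply, hf.1, hg.1, hq.1, Pi.zero_apply]
    ring
  have := hG.eq_of_weightedLaplacian_eq_zero h0 x z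
  simp only [Pi.sub_apply, hq.2] at this
  linarith

open Classical in
/-- The Poisson equation is solved by integrating the effective resistance. -/
lemma Connected.weightedLaplacian_sum_resistance {G : WeightedGraph V} (hG : G.Connected)
    {R : V → V → ℝ} (hR : G.IsEffectiveResistance R) {ι : Type*} [Fintype ι] (p : ι → V)
    (a : ι → ℝ) (ha : ∑ i, a i = 0) (z : V) :
    G.weightedLaplacian (fun w => -(1 / 2) * ∑ i, a i * R (p i) w) z
      = ∑ i, a i * (if z = p i then 1 else 0) := by
  choose f hf _ using fun i => hR (p i) z
  have hrepr : (fun w => -(1 / 2) * ∑ i, a i * R (p i) w)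
      = (fun _ => -(1 / 2) * ∑ i, a i * R (p i) z) + ∑ i, a i • f i := by
    ext w
    simp only [hG.isDirichletSolution_eq hR (hf _) w, Pi.add_apply, Finset.sum_apply,
      Pi.smul_apply, smul_eq_mul]
    have : ∑ i, a i * (R (p i) z + R w z - 2 * f i w)
        = ∑ i, a i * R (p i) z + (∑ i, a i) * R w z - 2 * ∑ i, a i * f i w := by
      rw [Finset.sum_mul, Finset.mul_sum, ← Finset.sum_add_distrib, ← Finset.sum_sub_distrib]
      exact Finset.sum_congr rfl fun i _ => by ring
    rw [this, ha]
    ring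
  rw [hrepr, map_add, weightedLaplacian_const, map_sum, zero_add, Finset.sum_apply]
  simp only [map_smul, Pi.smul_apply, smul_eq_mul,
    (hG.isDirichletSolution_iff.1 (hf _)).1, if_true, mul_sub, Finset.sum_sub_distrib, mul_one, ha,
    sub_zero]

/-- The weights of the graph with a given effective resistance decrease when the vertex set
grows. -/
lemma Connected.weight_le_of_embedding {W : Type*} [Fintype W] {G : WeightedGraph W}
    (hG : G.Connected) {H : WeightedGraph V} (hH : H.Connected) (e : W ↪ V) {R : V → V → ℝ}
    (hRG : G.IsEffectiveResistance fun x y => R (e x) (e y)) (hRH : H.IsEffectiveResistance R)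
    (x y : W) : H.weight (e x) (e y) ≤ G.weight x y := by
  classical
  rcases eq_or_ne x y with rfl | hxy
  · simp [weight_self]
  set u : W → ℝ := Pi.single y 1 with hu
  set a := G.weightedLaplacian u with ha
  have ha0 : ∑ i, a i = 0 := G.sum_weightedLaplacian u
  set h' : V → ℝ := fun w => -(1 / 2) * ∑ i, a i * R (e i) w with hh'
  have hGh : G.weightedLaplacian (h' ∘ e - u) = 0 := by
    ext z
    have := hG.weightedLaplacian_sum_resistance hRG id a ha0 z
    simp only [id, mul_ite, mul_one, mul_zero, Finset.sum_ite_eq, Finset.mem_univ, if_true] at this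
    rw [map_sub, Pi.sub_apply, Pi.zero_apply, sub_eq_zero]
    exact this
  set h : V → ℝ := h' - fun _ => h' (e x) - u x with hh
  have hext : ∀ z, h (e z) = u z := by
    intro z
    have := hG.eq_of_weightedLaplacian_eq_zero hGh z x
    simp only [Pi.sub_apply, Function.comp] at this
    simp only [hh, Pi.sub_apply]
    linarith
  have hL : ∀ z, H.weightedLaplacian h z = ∑ i, a i * (if z = e i then 1 else 0) := by
    intro z
    rw [hh, map_sub, weightedLaplacian_const, sub_zero]
    exact hH.weightedLaplacian_sum_resistance hRH e a ha0 z
  have hu0 : ∀ z, 0 ≤ u z := fun z => by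
    rw [hu, Pi.single_apply]; split_ifs <;> norm_num
  have hpos : ∀ w, 0 ≤ h w := by
    refine hH.nonneg_of_weightedLaplacian (fun z hz => ?_) (y := e x) (by rw [hext]; exact hu0 x)
    rw [hL]
    refine (Finset.sum_eq_zero fun i _ => ?_).ge
    rw [if_neg, mul_zero]
    rintro rfl
    rw [hext] at hz
    exact absurd (hu0 i) hz.not_ge
  have hux : u x = 0 := by rw [hu, Pi.single_eq_of_ne hxy]
  have huy : u y = 1 := by rw [hu, Pi.single_eq_same]
  have h1 := hL (e x)
  simp only [e.injective.eq_iff, mul_ite, mul_one, mul_zero, Finset.sum_ite_eq, Finset.mem_univ,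
    if_true] at h1
  have h2 : a x = -G.weight x y := by
    simp [ha, hu, weightedLaplacian_apply, Pi.single_apply, hxy]
  rw [h2, weightedLaplacian_apply, hext, hux] at h1
  simp only [zero_sub, mul_neg, Finset.sum_neg_distrib, neg_inj] at h1
  rw [← NNReal.coe_le_coe, ← h1]
  have := Finset.single_le_sum (f := fun w => (H.weight (e x) w : ℝ) * h w)
    (fun w _ => mul_nonneg (NNReal.coe_nonneg _) (hpos w)) (Finset.mem_univ (e y))
  simpa [hext, huy] using this

lemma Connected.one_le_vertexWeight_mul_resistance {G : WeightedGraph V} (hG : G.Connected)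
    {R : V → V → ℝ} (hR : G.IsEffectiveResistance R) {x y : V} (hxy : x ≠ y) :
    1 ≤ (G.vertexWeight x).toReal * R x y := by
  classical
  obtain ⟨f, hf, hfx⟩ := hR x y
  rw [hG.isDirichletSolution_iff] at hf
  have hpos : ∀ z, 0 ≤ f z := by
    refine hG.nonneg_of_weightedLaplacian (fun z hz => ?_) hf.2.ge
    rw [hf.1, if_neg (fun h : z = y => by rw [h, hf.2] at hz; exact lt_irrefl _ hz), sub_zero]
    split_ifs <;> norm_num
  have := hf.1 x
  rw [if_pos rfl, if_neg hxy, sub_zero, weightedLaplacian_apply] at this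
  rw [hfx, toReal_vertexWeight, Finset.sum_mul, ← this]
  exact Finset.sum_le_sum fun z _ =>
    mul_le_mul_of_nonneg_left (by linarith [hpos z]) (NNReal.coe_nonneg _)

end Laplacian

end WeightedGraph

namespace IsDirichletForm

variable {X : Type*} {F : QuadraticForm ℝ (X → ℝ)}

lemma apply_add_smul (F : QuadraticForm ℝ (X → ℝ)) (u v : X → ℝ) (t : ℝ) :
    F (u + t • v) = F u + t * F.polarBilin u v + t ^ 2 * F v := by
  have h : F.polarBilin u (t • v) = F (u + t • v) - F u - F (t • v) := rfl
  rw [map_smul, smul_eq_mul, QuadraticMap.map_smul, smul_eq_mul] at h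
  linarith

lemma polarBilin_const (hF : IsDirichletForm F) (u : X → ℝ) (k : ℝ) :
    F.polarBilin u (fun _ => k) = 0 := by
  have h0 : F (fun _ => k) = 0 := (hF.eq_zero_iff _).2 ⟨k, fun _ => rfl⟩
  by_contra hb
  have := hF.nonneg (u + (-(F u + 1) / F.polarBilin u (fun _ => k)) • fun _ => k)
  rw [apply_add_smul, h0, div_mul_cancel₀ _ hb] at this
  linarith

variable [DecidableEq X]

lemma polarBilin_single_nonpos (hF : IsDirichletForm F) {x y : X} (hxy : x ≠ y) :
    F.polarBilin (Pi.single x 1) (Pi.single y 1) ≤ 0 := by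
  set b := F.polarBilin (Pi.single x 1) (Pi.single y 1) with hb
  have key : ∀ t : ℝ, 0 < t → b ≤ t * F (Pi.single y 1) := by
    intro t ht
    have h := hF.markov (Pi.single x 1 + (-t) • Pi.single y 1)
    have hcut : (fun z => min 1 (max ((Pi.single x 1 + (-t) • Pi.single y 1 : X → ℝ) z) 0))
        = Pi.single x (1 : ℝ) := by
      ext z
      rcases eq_or_ne z x with rfl | hzx
      · simp [hxy]
      · rcases eq_or_ne z y with rfl | hzy
        · simp [hzx, ht.le]
        · simp [hzx, hzy]
    rw [hcut, apply_add_smul, ← hb] at h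
    have : t * b ≤ t * (t * F (Pi.single y 1)) := by nlinarith
    exact le_of_mul_le_mul_left this ht
  by_contra! hpos
  have hF1 := hF.nonneg (Pi.single y 1)
  have := key (b / (2 * (F (Pi.single y 1) + 1))) (by positivity)
  rw [div_mul_eq_mul_div, le_div_iff₀ (by positivity)] at this
  nlinarith

/-- The weighted graph whose energy is a given Dirichlet form. -/
def graph (_hF : IsDirichletForm F) : WeightedGraph X where
  weight x y := if x = y then 0 else
    (-(1 / 2) * F.polarBilin (Pi.single x 1) (Pi.single y 1)).toNNReal
  weight_self x := if_pos rfl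
  weight_symm x y := by
    have h : F.polarBilin (Pi.single x 1) (Pi.single y 1)
        = F.polarBilin (Pi.single y 1) (Pi.single x 1) := QuadraticMap.polar_comm F _ _
    simp only [eq_comm (a := x), h]

lemma coe_graph_weight (hF : IsDirichletForm F) {x y : X} (hxy : x ≠ y) :
    (hF.graph.weight x y : ℝ) = -(1 / 2) * F.polarBilin (Pi.single x 1) (Pi.single y 1) := by
  simp only [graph, if_neg hxy]
  exact Real.coe_toNNReal _ (by linarith [hF.polarBilin_single_nonpos hxy])

variable [Fintype X]

lemma weightedLaplacian_graph (hF : IsDirichletForm F) (u : X → ℝ) (x : X) :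
    hF.graph.weightedLaplacian u x = (1 / 2) * F.polarBilin (Pi.single x 1) u := by
  have h1 : u - (fun _ => u x) = ∑ y, (u y - u x) • (Pi.single y 1 : X → ℝ) := by
    ext z
    simp [Finset.sum_apply, Pi.single_apply]
  have h2 : F.polarBilin (Pi.single x 1) u
      = ∑ y, (u y - u x) * F.polarBilin (Pi.single x 1) (Pi.single y 1) := by
    rw [← sub_zero (F.polarBilin (Pi.single x 1) u), ← hF.polarBilin_const (Pi.single x 1) (u x),
      ← map_sub, h1, map_sum]
    simp only [map_smul, smul_eq_mul]
  rw [h2, WeightedGraph.weightedLaplacian_apply, Finset.mul_sum]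
  refine Finset.sum_congr rfl fun y _ => ?_
  rcases eq_or_ne x y with rfl | hxy
  · simp
  · rw [hF.coe_graph_weight hxy]; ring

lemma sum_mul_weightedLaplacian_graph (hF : IsDirichletForm F) (u v : X → ℝ) :
    ∑ x, v x * hF.graph.weightedLaplacian u x = (1 / 2) * F.polarBilin v u := by
  have h : v = ∑ x, v x • (Pi.single x 1 : X → ℝ) := by
    ext z
    simp [Finset.sum_apply, Pi.single_apply]
  conv_rhs => rw [h]
  simp only [map_sum, map_smul, LinearMap.sum_apply, LinearMap.smul_apply, smul_eq_mul,
    weightedLaplacian_graph, Finset.mul_sum]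
  exact Finset.sum_congr rfl fun y _ => by ring

lemma sum_mul_weightedLaplacian_graph_self (hF : IsDirichletForm F) (u : X → ℝ) :
    ∑ x, u x * hF.graph.weightedLaplacian u x = F u := by
  rw [sum_mul_weightedLaplacian_graph]
  have : F.polarBilin u u = 2 • F u := QuadraticMap.polar_self F u
  rw [this, two_nsmul]
  ring

lemma connected_graph [Nonempty X] (hF : IsDirichletForm F) : hF.graph.Connected := by
  classical
  refine (SimpleGraph.connected_iff _).2 ⟨fun x y => ?_, inferInstance⟩
  set u : X → ℝ := fun z => if hF.graph.toSimpleGraph.Reachable x z then 1 else 0 with hu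
  have hL : hF.graph.weightedLaplacian u = 0 := by
    ext z
    refine Finset.sum_eq_zero fun w _ => ?_
    by_cases hzw : hF.graph.weight z w = 0
    · simp [hzw]
    · have hadj : hF.graph.toSimpleGraph.Adj z w := pos_iff_ne_zero.2 hzw
      have : hF.graph.toSimpleGraph.Reachable x z ↔ hF.graph.toSimpleGraph.Reachable x w :=
        ⟨fun h => h.trans hadj.reachable, fun h => h.trans hadj.symm.reachable⟩
      simp [hu, this]
  have hFu : F u = 0 := by simp [← hF.sum_mul_weightedLaplacian_graph_self, hL]
  obtain ⟨k, hk⟩ := (hF.eq_zero_iff u).1 hFu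
  have hxy : u y = u x := (hk y).trans (hk x).symm
  by_contra hn
  simp [hu, hn] at hxy

lemma exists_weightedLaplacian_graph_eq (hF : IsDirichletForm F) (x y : X) :
    ∃ f : X → ℝ, (∀ z, hF.graph.weightedLaplacian f z
      = (if z = x then 1 else 0) - (if z = y then 1 else 0)) ∧ f y = 0 := by
  set T : (X → ℝ) →ₗ[ℝ] (X → ℝ) :=
    LinearMap.pi fun z => if z = y then LinearMap.proj y else
      (LinearMap.proj z).comp hF.graph.weightedLaplacian with hT
  have hTy : ∀ f, T f y = f y := fun f => by simp [hT]
  have hTz : ∀ f z, z ≠ y → T f z = hF.graph.weightedLaplacian f z := fun f z hz => by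
    simp [hT, hz]
  have hinj : Function.Injective T := by
    rw [← LinearMap.ker_eq_bot, LinearMap.ker_eq_bot']
    intro f hf
    have hfy : f y = 0 := by rw [← hTy f, hf]; rfl
    have hFf : F f = 0 := by
      rw [← hF.sum_mul_weightedLaplacian_graph_self]
      refine Finset.sum_eq_zero fun z _ => ?_
      rcases eq_or_ne z y with rfl | hz
      · rw [hfy, zero_mul]
      · rw [← hTz f z hz, hf]; simp
    obtain ⟨k, hk⟩ := (hF.eq_zero_iff f).1 hFf
    ext z
    rw [hk z, ← hk y, hfy]; rfl
  obtain ⟨f, hf⟩ := LinearMap.surjective_of_injective hinj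
    (fun z => (if z = x then 1 else 0) - (if z = y then (if x = y then 1 else 0) else 0))
  have hfy : f y = 0 := by
    rw [← hTy f, hf]
    simp [eq_comm (a := x)]
  have hoff : ∀ z, z ≠ y → hF.graph.weightedLaplacian f z
      = (if z = x then 1 else 0) - (if z = y then 1 else 0) := fun z hz => by
    rw [← hTz f z hz, hf]; simp [hz]
  refine ⟨f, fun z => ?_, hfy⟩
  rcases eq_or_ne z y with rfl | hz
  · have h1 := hF.graph.sum_weightedLaplacian f
    have h2 : ∑ w, ((if w = x then (1 : ℝ) else 0) - (if w = z then 1 else 0)) = 0 := by simp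
    rw [← Finset.add_sum_erase _ _ (Finset.mem_univ z)] at h1 h2
    rw [Finset.sum_congr rfl fun w hw => hoff w (Finset.ne_of_mem_erase hw)] at h1
    linarith
  · exact hoff z hz

lemma dirichletResistance_eq (hF : IsDirichletForm F) {x y : X} {f : X → ℝ}
    (hf : ∀ z, hF.graph.weightedLaplacian f z
      = (if z = x then 1 else 0) - (if z = y then 1 else 0)) (hfy : f y = 0) :
    dirichletResistance F x y = f x := by
  rcases eq_or_ne x y with rfl | hxy
  · have : {r : ℝ | ∃ u : X → ℝ, u x = 1 ∧ u x = 0 ∧ F u = r} = ∅ := by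
      ext r
      simp only [Set.mem_ofPred_eq, Set.mem_empty_iff_false, iff_false]
      rintro ⟨u, h1, h0, -⟩
      linarith
    rw [dirichletResistance, this, Real.sInf_empty, inv_zero, hfy]
  have hpair : ∀ u : X → ℝ, (1 / 2) * F.polarBilin u f = u x - u y := by
    intro u
    rw [← hF.sum_mul_weightedLaplacian_graph]
    simp [hf, mul_sub]
  have hFf : F f = f x := by
    rw [← hF.sum_mul_weightedLaplacian_graph_self, hF.sum_mul_weightedLaplacian_graph, hpair, hfy,
      sub_zero]
  have hfx : f x ≠ 0 := by
    intro h0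
    obtain ⟨k, hk⟩ := (hF.eq_zero_iff f).1 (hFf.trans h0)
    have hc : f = fun _ => k := funext hk
    have := hf x
    rw [hc, WeightedGraph.weightedLaplacian_const] at this
    simp [hxy] at this
  have hleast : IsLeast {r : ℝ | ∃ u : X → ℝ, u x = 1 ∧ u y = 0 ∧ F u = r} (f x)⁻¹ := by
    constructor
    · refine ⟨(f x)⁻¹ • f, by simp [hfx], by simp [hfy], ?_⟩
      rw [QuadraticMap.map_smul, hFf, smul_eq_mul]
      field_simp
    · rintro r ⟨u, hux, huy, rfl⟩
      have h := hF.nonneg (u + (-(f x)⁻¹) • f)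
      have hp := hpair u
      rw [hux, huy] at hp
      rw [apply_add_smul, hFf, show F.polarBilin u f = 2 by linarith] at h
      have : (-(f x)⁻¹) ^ 2 * f x = (f x)⁻¹ := by field_simp
      linarith
  rw [dirichletResistance, hleast.csInf_eq, inv_inv]

lemma isEffectiveResistance_graph [Nonempty X] (hF : IsDirichletForm F) :
    hF.graph.IsEffectiveResistance (dirichletResistance F) := by
  intro x y
  obtain ⟨f, hf, hfy⟩ := hF.exists_weightedLaplacian_graph_eq x y
  refine ⟨f, hF.connected_graph.isDirichletSolution_iff.2 ⟨fun z => ?_, hfy⟩,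
    hF.dirichletResistance_eq hf hfy⟩
  rw [hf]
  congr

end IsDirichletForm

section ResistanceGraph

variable {V : Type*} {R : V → V → ℝ}

lemma IsResistanceMetric.resistanceGraph_spec (hR : IsResistanceMetric R) {W : Finset V}
    (hW : W.Nonempty) : (resistanceGraph R W).Connected ∧
      (resistanceGraph R W).IsEffectiveResistance fun x y => R x y := by
  classical
  have h : ∃ G : WeightedGraph W, G.Connected ∧ G.IsEffectiveResistance fun x y => R x y := by
    have : Nonempty W := hW.to_subtype
    obtain ⟨F, hF, hRF⟩ := hR.2 W
    exact ⟨hF.graph, hF.connected_graph, by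
      simpa only [hRF] using hF.isEffectiveResistance_graph⟩
  rw [resistanceGraph, dif_pos h]
  exact h.choose_spec

lemma WeightedGraph.extend_weight_of_mem {W : Finset V} (G : WeightedGraph W) {x y : V}
    (hx : x ∈ W) (hy : y ∈ W) : G.extend.weight x y = G.weight ⟨x, hx⟩ ⟨y, hy⟩ :=
  dif_pos ⟨hx, hy⟩

lemma WeightedGraph.vertexWeight_extend {W : Finset V} (G : WeightedGraph W) (x : W) :
    G.extend.vertexWeight x = G.vertexWeight x := by
  rw [vertexWeight, vertexWeight, tsum_eq_sum (s := W), tsum_fintype, ← Finset.sum_coe_sort W]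
  · exact Finset.sum_congr rfl fun y _ => by rw [extend_weight_of_mem G x.2 y.2]
  · intro y hy
    have : G.extend.weight x y = 0 := dif_neg fun h => hy h.2
    rw [this, ENNReal.coe_zero]

lemma IsResistanceMetric.approxGraph_weight_le (hR : IsResistanceMetric R) {Vn : ℕ → Finset V}
    {m n : ℕ} (hmn : Vn m ⊆ Vn n) {x y : V} (hx : x ∈ Vn m) (hy : y ∈ Vn m) :
    (approxGraph R Vn n).weight x y ≤ (approxGraph R Vn m).weight x y := by
  obtain ⟨hm, hm'⟩ := hR.resistanceGraph_spec ⟨x, hx⟩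
  obtain ⟨hn, hn'⟩ := hR.resistanceGraph_spec ⟨x, hmn hx⟩
  rw [approxGraph, approxGraph, WeightedGraph.extend_weight_of_mem _ hx hy,
    WeightedGraph.extend_weight_of_mem _ (hmn hx) (hmn hy)]
  exact hm.weight_le_of_embedding hn (Set.embeddingOfSubset _ _ hmn) hm' hn' ⟨x, hx⟩ ⟨y, hy⟩

lemma IsFiniteExhaustion.monotone {Vn : ℕ → Finset V} (hVn : IsFiniteExhaustion Vn) :
    Monotone Vn := monotone_nat_of_le_succ hVn.1

/-- The weights of the approximating graphs converge to those of the limit graph. -/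
lemma IsResistanceMetric.tendsto_approxGraph_weight (hR : IsResistanceMetric R)
    {Vn : ℕ → Finset V} (hVn : IsFiniteExhaustion Vn) (x y : V) :
    Tendsto (fun n => (approxGraph R Vn n).weight x y) atTop
      (𝓝 ((limitGraph R Vn).weight x y)) := by
  refine tendsto_nhds_limUnder ?_
  obtain ⟨k, hk⟩ := hVn.2 x
  obtain ⟨l, hl⟩ := hVn.2 y
  have hmem : ∀ n, x ∈ Vn (n + max k l) ∧ y ∈ Vn (n + max k l) := fun n =>
    ⟨hVn.monotone (by omega) hk, hVn.monotone (by omega) hl⟩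
  have hanti : Antitone fun n => (approxGraph R Vn (n + max k l)).weight x y := fun m n hmn =>
    hR.approxGraph_weight_le (hVn.monotone (by omega)) (hmem m).1 (hmem m).2
  exact ⟨_, (tendsto_add_atTop_iff_nat (max k l)).1
    (tendsto_atTop_ciInf hanti (OrderBot.bddBelow _))⟩

lemma IsResistanceMetric.limitGraph_vertexWeight_ne_zero [Infinite V] (hR : IsResistanceMetric R)
    {Vn : ℕ → Finset V} (hVn : IsFiniteExhaustion Vn) {x : V}
    (hlim : Tendsto (fun n => (approxGraph R Vn n).vertexWeight x) atTop
      (𝓝 ((limitGraph R Vn).vertexWeight x))) :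
    (limitGraph R Vn).vertexWeight x ≠ 0 := by
  obtain ⟨y, hy⟩ := exists_ne x
  obtain ⟨k, hk⟩ := hVn.2 x
  obtain ⟨l, hl⟩ := hVn.2 y
  have hbound : ∀ n, max k l ≤ n →
      ENNReal.ofReal (R x y)⁻¹ ≤ (approxGraph R Vn n).vertexWeight x ∧ 0 < R x y := by
    intro n hn
    have hx : x ∈ Vn n := hVn.monotone (by omega) hk
    have hy' : y ∈ Vn n := hVn.monotone (by omega) hl
    obtain ⟨h1, h2⟩ := hR.resistanceGraph_spec ⟨x, hx⟩
    have h := h1.one_le_vertexWeight_mul_resistance h2 (x := ⟨x, hx⟩) (y := ⟨y, hy'⟩)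
      (fun h => hy (congrArg Subtype.val h).symm)
    have hpos : 0 < R x y := by
      refine (hR.1 x y).lt_of_ne fun h0 => ?_
      rw [← h0, mul_zero] at h
      linarith
    refine ⟨?_, hpos⟩
    rw [approxGraph, WeightedGraph.vertexWeight_extend _ ⟨x, hx⟩]
    refine ENNReal.ofReal_le_of_le_toReal ?_
    rw [inv_le_iff_one_le_mul₀ hpos]
    exact h
  have hle := ge_of_tendsto hlim ((eventually_ge_atTop (max k l)).mono fun n hn => (hbound n hn).1)
  exact ((ENNReal.ofReal_pos.2 (inv_pos.2 (hbound _ le_rfl).2)).trans_le hle).ne'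

end ResistanceGraph


namespace WeightedGraph

variable {V : Type*}

lemma stepPMF_apply (G : WeightedGraph V) {y : V} (h0 : G.vertexWeight y ≠ 0)
    (ht : G.vertexWeight y ≠ ∞) (z : V) :
    G.stepPMF y z = G.weight y z / G.vertexWeight y := by
  rw [stepPMF, dif_pos ⟨h0, ht⟩]
  exact (PMF.normalize_apply h0 ht z).trans (div_eq_mul_inv _ _).symm

lemma tendsto_stepPMF {ι : Type*} {l : Filter ι} {G : ι → WeightedGraph V} {H : WeightedGraph V}
    {y : V} (hw : ∀ z, Tendsto (fun i => (G i).weight y z) l (𝓝 (H.weight y z)))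
    (hv : Tendsto (fun i => (G i).vertexWeight y) l (𝓝 (H.vertexWeight y)))
    (h0 : H.vertexWeight y ≠ 0) (ht : H.vertexWeight y ≠ ∞) (z : V) :
    Tendsto (fun i => (G i).stepPMF y z) l (𝓝 (H.stepPMF y z)) := by
  rw [stepPMF_apply H h0 ht]
  refine (ENNReal.Tendsto.div (ENNReal.tendsto_coe.2 (hw z)) (Or.inr h0) hv (Or.inr ?_)).congr' ?_
  · exact ENNReal.coe_ne_top
  · filter_upwards [hv.eventually_ne h0, hv.eventually_ne ht] with i hi0 hit
    rw [stepPMF_apply _ hi0 hit]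

/-- The trajectories that agree with `a` up to time `n`. -/
def pathCylinder (a : ℕ → V) (n : ℕ) : Set (ℕ → V) := {ω | ∀ i ≤ n, ω i = a i}

lemma pathCylinder_eq_of_mem {a b : ℕ → V} {n : ℕ} (h : b ∈ pathCylinder a n) :
    pathCylinder b n = pathCylinder a n := by
  ext ω
  exact forall₂_congr fun i hi => by rw [h i hi]

lemma pathCylinder_anti (a : ℕ → V) : Antitone (pathCylinder a) :=
  fun _ _ hmn _ hω i hi => hω i (hi.trans hmn)

lemma isPiSystem_pathCylinder : IsPiSystem {s : Set (ℕ → V) | ∃ a n, s = pathCylinder a n} := by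
  rintro _ ⟨a, m, rfl⟩ _ ⟨b, n, rfl⟩ ⟨ω, ha, hb⟩
  refine ⟨ω, max m n, ?_⟩
  rw [← pathCylinder_eq_of_mem ha, ← pathCylinder_eq_of_mem hb]
  ext η
  constructor
  · rintro ⟨h1, h2⟩ i hi
    rcases le_max_iff.1 hi with h | h
    · exact h1 i h
    · exact h2 i h
  · intro h
    exact ⟨pathCylinder_anti ω (le_max_left _ _) h, pathCylinder_anti ω (le_max_right _ _) h⟩

lemma pathCylinder_eq_pi (a : ℕ → V) (n : ℕ) :
    pathCylinder a n = (Set.Iic n).pi fun i => {a i} := by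
  ext; simp [pathCylinder]

lemma pathCylinder_mem_nhds [TopologicalSpace V] [DiscreteTopology V] (a : ℕ → V) (n : ℕ) :
    pathCylinder a n ∈ 𝓝 a := by
  rw [pathCylinder_eq_pi]
  exact set_pi_mem_nhds (Set.finite_Iic n) fun i _ => by simp

lemma exists_pathCylinder_subset [TopologicalSpace V] {u : Set (ℕ → V)}
    (hu : IsOpen u) {a : ℕ → V} (ha : a ∈ u) : ∃ n, pathCylinder a n ⊆ u := by
  obtain ⟨I, t, ht, hsub⟩ := isOpen_pi_iff.1 hu a ha
  refine ⟨I.sup id, fun ω hω => hsub fun i hi => ?_⟩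
  rw [hω i (Finset.le_sup (f := id) hi)]
  exact (ht i hi).2

variable [MeasurableSpace V] [DiscreteMeasurableSpace V]

lemma measurableSet_pathCylinder (a : ℕ → V) (n : ℕ) : MeasurableSet (pathCylinder a n) := by
  rw [pathCylinder_eq_pi]
  exact MeasurableSet.pi (Set.to_countable _) fun i _ => MeasurableSet.of_discrete

lemma coe_randomWalk (G : WeightedGraph V) (x : V) :
    (G.randomWalk x : Measure (ℕ → V)) =
      Kernel.traj (X := fun _ => V) G.pathKernel 0 (fun _ => x) := rfl

open Classical in
lemma randomWalk_pathCylinder_zero (G : WeightedGraph V) (x : V) (a : ℕ → V) :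
    (G.randomWalk x : Measure (ℕ → V)) (pathCylinder a 0) = if a 0 = x then 1 else 0 := by
  set A : Set ((i : Finset.Iic 0) → V) :=
    (fun f => f ⟨0, Finset.mem_Iic.2 le_rfl⟩) ⁻¹' {a 0} with hA
  have hpre : pathCylinder a 0 = Preorder.frestrictLe (π := fun _ => V) 0 ⁻¹' A := by
    ext ω; simp [pathCylinder, hA]
  have hm : MeasurableSet A := measurable_pi_apply
    (X := fun _ : Finset.Iic 0 => V) _ (MeasurableSet.singleton (a 0))
  rw [coe_randomWalk, hpre, ← Measure.map_apply (by fun_prop) hm, Kernel.traj_map_frestrictLe_apply,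
    Kernel.partialTraj_self, Kernel.id_apply, Measure.dirac_apply' _ hm]
  simp [Set.indicator_apply, hA, eq_comm]

lemma randomWalk_pathCylinder_succ (G : WeightedGraph V) (x : V) (a : ℕ → V) (n : ℕ) :
    (G.randomWalk x : Measure (ℕ → V)) (pathCylinder a (n + 1)) =
      (G.randomWalk x : Measure (ℕ → V)) (pathCylinder a n) * G.stepPMF (a n) (a (n + 1)) := by
  set A : Set ((i : Finset.Iic n) → V) := {f | ∀ i, f i = a i} with hA
  have hmA : MeasurableSet A := by
    have : A = Set.univ.pi fun i : Finset.Iic n => {a i} := by ext; simp [hA]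
    rw [this]
    exact MeasurableSet.pi Set.countable_univ fun i _ => MeasurableSet.of_discrete
  have hpre : pathCylinder a n = Preorder.frestrictLe (π := fun _ => V) n ⁻¹' A := by
    ext ω; simp [pathCylinder, hA]
  have hpre' : pathCylinder a (n + 1) =
      (fun ω : ℕ → V => (Preorder.frestrictLe (π := fun _ => V) n ω, ω (n + 1))) ⁻¹'
        (A ×ˢ {a (n + 1)}) := by
    ext ω
    simp only [pathCylinder, Set.mem_ofPred_eq, Set.mem_preimage, Set.mem_prod, hA,
      Set.mem_singleton_iff, Subtype.forall, Finset.mem_Iic, Preorder.frestrictLe_apply]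
    exact ⟨fun h => ⟨fun i hi => h i (hi.trans n.le_succ), h _ le_rfl⟩, fun h i hi => by
      rcases Nat.le_succ_iff.1 hi with h' | rfl
      · exact h.1 i h'
      · exact h.2⟩
  rw [coe_randomWalk, hpre', ← Measure.map_apply (by fun_prop)
    (hmA.prod (MeasurableSet.singleton _)), ← Kernel.partialTraj_compProd_eq_map_traj (Nat.zero_le n),
    Measure.compProd_apply_prod hmA (MeasurableSet.singleton _), hpre,
    ← Measure.map_apply (by fun_prop) hmA, Kernel.traj_map_frestrictLe_apply,
    setLIntegral_congr_fun (g := fun _ => G.stepPMF (a n) (a (n + 1))) hmA, setLIntegral_const,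
    mul_comm]
  intro f hf
  change (G.stepPMF (f ⟨n, _⟩)).toMeasure {a (n + 1)} = _
  rw [PMF.toMeasure_apply_singleton _ _ (MeasurableSet.singleton _), hf]

/-- If all transition probabilities converge, the laws of the random walks converge weakly. -/
lemma tendsto_randomWalk [Countable V] [TopologicalSpace V] [DiscreteTopology V] {ι : Type*} {l : Filter ι}
    [l.IsCountablyGenerated] {G : ι → WeightedGraph V} {H : WeightedGraph V}
    (h : ∀ y z, Tendsto (fun i => (G i).stepPMF y z) l (𝓝 (H.stepPMF y z))) (x : V) :
    Tendsto (fun i => (G i).randomWalk x) l (𝓝 (H.randomWalk x)) := by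
  have hcyl : ∀ a n, Tendsto
      (fun i => ((G i).randomWalk x : Measure (ℕ → V)) (pathCylinder a n)) l
      (𝓝 ((H.randomWalk x : Measure (ℕ → V)) (pathCylinder a n))) := by
    intro a n
    induction n with
    | zero => simp only [randomWalk_pathCylinder_zero]; exact tendsto_const_nhds
    | succ n ih =>
      simp only [randomWalk_pathCylinder_succ]
      exact ENNReal.Tendsto.mul ih (Or.inr (PMF.apply_ne_top _ _)) (h _ _)
        (Or.inr (measure_ne_top _ _))
  refine isPiSystem_pathCylinder.tendsto_probabilityMeasure_of_tendsto_of_mem ?_ ?_ ?_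
  · rintro _ ⟨a, n, rfl⟩
    exact measurableSet_pathCylinder a n
  · intro u hu a ha
    obtain ⟨n, hn⟩ := exists_pathCylinder_subset hu ha
    exact ⟨_, ⟨a, n, rfl⟩, pathCylinder_mem_nhds a n, hn⟩
  · rintro _ ⟨a, n, rfl⟩
    exact (ENNReal.tendsto_toNNReal (measure_ne_top _ _)).comp (hcyl a n)

end WeightedGraph

end

theorem mainTheorem6 {V : Type*} [Countable V] [Infinite V]
    [TopologicalSpace V] [DiscreteTopology V] [MeasurableSpace V] [DiscreteMeasurableSpace V]
    (R : V → V → ℝ) (hR : IsResistanceMetric R)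
    (Vn : ℕ → Finset V) (hVn : IsFiniteExhaustion Vn)
    (hlim : ∀ x, Tendsto (fun n => (approxGraph R Vn n).vertexWeight x) atTop
      (𝓝 ((limitGraph R Vn).vertexWeight x)))
    (hfin : ∀ x, (limitGraph R Vn).vertexWeight x < ∞)
    (x : V) :
    Tendsto (fun n => (approxGraph R Vn n).randomWalk x) atTop
      (𝓝 ((limitGraph R Vn).randomWalk x)) :=
  WeightedGraph.tendsto_randomWalk (fun y z => WeightedGraph.tendsto_stepPMF
    (fun w => hR.tendsto_approxGraph_weight hVn y w) (hlim y)
    (hR.limitGraph_vertexWeight_ne_zero hVn (hlim y)) (hfin y).ne z) x
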